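/- All Hilbert spaces are complex and separable, and $\dim$ takes values in $\mathbb{N}\cup\{\infty\}$. For $n\in\mathbb{N}\cup\{\infty\}$ let $\mathcal{S}_n(\mathcal{H})$ be the set of densely defined, closed, symmetric linear operators $T:\mathscr{D}(T)\subset\mathcal{H}\to\mathcal{H}$ that are simple, i.e. $\bigcap_{\Im\lambda\neq 0}\operatorname{Rng}(T-\lambda I)=\{0\}$, and satisfy $\dim\operatorname{Rng}(T-iI)^{\perp}=\dim\operatorname{Rng}(T+iI)^{\perp}=n$. Let $\mathcal{K}$ be a Hilbert space of dimension $n$. A model for $T\in\mathcal{S}_n(\mathcal{H})$ is a co-analytic function $\Gamma:\mathbb{C}\setminus\mathbb{R}\to\mathcal{B}(\mathcal{K},\mathcal{H})$ (that is, $z\mapsto\Gamma(\bar z)$ is analytic) such that (a) $\Gamma(\lambda):\mathcal{K}\to\operatorname{Rng}(T-\lambda I)^{\perp}$ is boundedly invertible for every $\lambda\in\mathbb{C}\setminus\mathbb{R}$; (b) $\Gamma(z)^*\Gamma(\lambda):\mathcal{K}\to\mathcal{K}$ is invertible whenever $\lambda,z$ both lie in $\mathbb{C}_+=\{\Im z>0\}$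 or both lie in $\mathbb{C}_-=\{\Im z<0\}$; (c) the closed linear span of the ranges $\operatorname{Rng}\Gamma(\lambda)$, $\lambda\in\mathbb{C}\setminus\mathbb{R}$, is $\mathcal{H}$. Given a model $\Gamma$, put $K_\lambda(z)=\Gamma(z)^*\Gamma(\lambda)$, which is the reproducing kernel of the space of functions $z\mapsto\Gamma(z)^*f$, $f\in\mathcal{H}$, with the inner product of $\mathcal{H}$. Let $$b(z)=\frac{z-i}{z+i},\qquad \Phi(z)=K_i(z)K_i(i)^{-1/2},\qquad \Psi(z)=K_{-i}(z)K_{-i}(-i)^{-1/2},$$ $$V(z)=b(z)\,\Phi(z)^{-1}\Psi(z),\qquad z\in\mathbb{C}_+ .$$ **Corollary.** Let $n\in\mathbb{N}\cup\{\infty\}$, let $T_1\in\mathcal{S}_n(\mathcal{H}_1)$ and $T_2\in\mathcal{S}_n(\mathcal{H}_2)$, let $\Gamma_1,\Gamma_2$ be any models for $T_1,T_2$ with the same space $\mathcal{K}$, and let $V_1,V_2$ be the corresponding functions $V$. Then $T_1$ and $T_2$ are unitarily equivalent, i.e. there is a unitary $U:\mathcal{H}_1\to\mathcal{H}_2$ with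 $U\mathscr{D}(T_1)=\mathscr{D}(T_2)$ and $UT_1x=T_2Ux$ for all $x\in\mathscr{D}(T_1)$, if and only if there are constant unitary operators $R,Q$ on $\mathcal{K}$ such that $$V_1(z)=R\,V_2(z)\,Q\qquad\text{for all } z\in\mathbb{C}_+ .$$ -/

import Mathlib

open Complex ComplexConjugate

noncomputable section

namespace SymmetricOperator

variable {H H₁ H₂ K : Type*}
  [NormedAddCommGroup H] [InnerProductSpace ℂ H]
  [NormedAddCommGroup H₁] [InnerProductSpace ℂ H₁]
  [NormedAddCommGroup H₂] [InnerProductSpace ℂ H₂]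
  [NormedAddCommGroup K] [InnerProductSpace ℂ K]

/-- The dimension of a separable Hilbert space as an element of `ℕ ∪ {∞}`: the number of elements
of a basis if it is finite dimensional and `∞` otherwise. (All infinite orthonormal bases of a
separable Hilbert space are countable, so that a single value `∞` suffices.) -/
def hilbertDim (E : Type*) [NormedAddCommGroup E] [InnerProductSpace ℂ E] : ℕ∞ :=
  Cardinal.toENat (Module.rank ℂ E)

/-- The range `Rng (T - w I)` of a partially defined linear operator, `{T x - w x : x ∈ D(T)}`. -/
def rng (T : H →ₗ.[ℂ] H) (w : ℂ) : Submodule ℂ H :=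
  LinearMap.range (T.toFun - w • T.domain.subtype)

/-- The class `𝒮ₙ(H)`: simple, closed, symmetric, densely defined operators with deficiency
indices `(n, n)`, where `n ∈ ℕ ∪ {∞}`. -/
structure IsInClass (n : ℕ∞) (T : H →ₗ.[ℂ] H) : Prop where
  dense : Dense (T.domain : Set H)
  symmetric : ∀ x y : T.domain, inner ℂ (T x) (y : H) = inner ℂ (x : H) (T y)
  simple : ⨅ (w : ℂ) (_ : w.im ≠ 0), rng T w = ⊥
  closed : IsClosed {p : H × H | ∃ x : T.domain, p = ((x : H), T x)}
  deficiency_minus : hilbertDim (rng T I)ᗮ = n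
  deficiency_plus : hilbertDim (rng T (-I))ᗮ = n

/-- Unitary equivalence of partially defined operators: there is a unitary `U` from `H₁` onto `H₂`
with `U D(T₁) = D(T₂)` and `U T₁ = T₂ U` on `D(T₁)`. -/
def UnitarilyEquivalent (T₁ : H₁ →ₗ.[ℂ] H₁) (T₂ : H₂ →ₗ.[ℂ] H₂) : Prop :=
  ∃ U : H₁ ≃ₗᵢ[ℂ] H₂,
    (∀ x : H₁, x ∈ T₁.domain ↔ U x ∈ T₂.domain) ∧
    ∀ (x : T₁.domain) (y : T₂.domain), U (x : H₁) = (y : H₂) → U (T₁ x) = T₂ y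

variable [CompleteSpace H] [CompleteSpace K]

/-- The transform `f̂(z) = Γ(z)* f`; the functions `f̂`, with `⟨f̂, ĝ⟩ = ⟨f, g⟩`, form the model
space `ℋ(Γ)`. -/
def modelTransform (Γ : ℂ → K →L[ℂ] H) (f : H) (z : ℂ) : K :=
  ContinuousLinearMap.adjoint (Γ z) f

/-- The operator-valued kernel `K_w(z) = Γ(z)* Γ(w)` of the model space `ℋ(Γ)`. -/
def kernel (Γ : ℂ → K →L[ℂ] H) (w z : ℂ) : K →L[ℂ] K :=
  (ContinuousLinearMap.adjoint (Γ z)) ∘L (Γ w)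

/-- `kernel Γ` is the reproducing kernel of `ℋ(Γ)`: the function `z ↦ K_w(z) a` is the transform of
a vector `k` of `H`, and pairing with it evaluates transforms at `w` in the direction `a`. -/
theorem kernel_reproducing (Γ : ℂ → K →L[ℂ] H) (w : ℂ) (a : K) :
    ∃ k : H, (∀ z, modelTransform Γ k z = kernel Γ w z a) ∧
      ∀ f : H, inner ℂ a (modelTransform Γ f w) = inner ℂ k f :=
  ⟨Γ w a, fun _ => rfl, fun f => ContinuousLinearMap.adjoint_inner_right (Γ w) a f⟩

/-- `Γ` is a model for `T`. Only the values of `Γ` on `ℂ \ ℝ` matter. -/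
structure IsModel (T : H →ₗ.[ℂ] H) (Γ : ℂ → K →L[ℂ] H) : Prop where
  /-- `Γ` is co-analytic on `ℂ \ ℝ`: `z ↦ Γ(z̄)` is analytic there, in operator norm. -/
  coanalytic : AnalyticOnNhd ℂ (fun z : ℂ => Γ (conj z)) {z : ℂ | z.im ≠ 0}
  /-- `Γ(w)` is a bounded invertible map of `K` onto `Rng (T - w I)ᗮ`. -/
  invertible : ∀ w : ℂ, w.im ≠ 0 → ∃ e : K ≃L[ℂ] (rng T w)ᗮ, ∀ a : K, (e a : H) = Γ w a
  /-- `Γ(z)* Γ(w)` is invertible if `w`, `z` lie in the same half plane. -/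
  kernel_invertible : ∀ w z : ℂ, (0 < w.im ∧ 0 < z.im) ∨ (w.im < 0 ∧ z.im < 0) →
    IsUnit (kernel Γ w z)
  /-- The ranges of the `Γ(w)` span a dense subspace of `H`. -/
  span_dense : (⨆ (w : ℂ) (_ : w.im ≠ 0), LinearMap.range (Γ w).toLinearMap).topologicalClosure = ⊤

/-- The Blaschke factor `b(z) = (z - i) / (z + i)`. -/
def blaschke (z : ℂ) : ℂ := (z - I) / (z + I)

/-- `Φ(z) = K_i(z) K_i(i)^{-1/2}`; the power is taken in the functional calculus of the positive
operator `K_i(i)`. -/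
def Phi (Γ : ℂ → K →L[ℂ] H) (z : ℂ) : K →L[ℂ] K :=
  kernel Γ I z * kernel Γ I I ^ (-(1 / 2) : ℝ)

/-- `Ψ(z) = K_{-i}(z) K_{-i}(-i)^{-1/2}`. -/
def Psi (Γ : ℂ → K →L[ℂ] H) (z : ℂ) : K →L[ℂ] K :=
  kernel Γ (-I) z * kernel Γ (-I) (-I) ^ (-(1 / 2) : ℝ)

/-- `V(z) = b(z) Φ(z)⁻¹ Ψ(z)`, used for `z` in the upper half plane, where `Φ(z)` is invertible for
every model. -/
def charFun (Γ : ℂ → K →L[ℂ] H) (z : ℂ) : K →L[ℂ] K :=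
  blaschke z • (Ring.inverse (Phi Γ z) * Psi Γ z)

end SymmetricOperator

end

noncomputable section

namespace SymmetricOperator

variable {H H₁ H₂ K : Type*}
  [NormedAddCommGroup H] [InnerProductSpace ℂ H]
  [NormedAddCommGroup H₁] [InnerProductSpace ℂ H₁]
  [NormedAddCommGroup H₂] [InnerProductSpace ℂ H₂]
  [NormedAddCommGroup K] [InnerProductSpace ℂ K]

/-! Put `f̂(z) = Γ(z)* f`. Since `Γ(z)*` kills `Rng (T - zI)`, `T` becomes multiplication by `z` on
the transforms, with maximal domain (`adjoint_eq_smul_iff`). So the kernel, up to `K_w(z) ↦ G(z)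
K_w(z) G(w)*` with invertible `G`, determines `T` up to unitary equivalence. `Φ` and `Ψ` determine
the kernel: `kernel_identity` gives `2i(w̄ - z) K_w(z) = (w̄ - i)(z + i) Φ(z)Φ(w)* - (w̄ + i)(z - i)
Ψ(z)Ψ(w)*`. Given a unitary equivalence `U`, write `U Γ₁(w) = Γ₂(w) g(w)`. Then `Φ₁ = g* Φ₂ A` and
`Ψ₁ = g* Ψ₂ B` with `A`, `B` unitary, and `g*` cancels in `Φ⁻¹Ψ`. Conversely, `V₁ = R V₂ Q` yields
one invertible `G` with `Φ₁ = G Φ₂ R*` and `Ψ₁ = G Ψ₂ Q` in both half planes, so `kernel_identity`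
transports the kernel (`kernel_eq_transition_mul`). -/

theorem mem_rng {T : H →ₗ.[ℂ] H} {w : ℂ} {y : H} :
    y ∈ rng T w ↔ ∃ x : T.domain, T x - w • (x : H) = y := Iff.rfl

/-! ### Graph norm and closed ranges -/

namespace IsInClass

variable {n : ℕ∞} {T : H →ₗ.[ℂ] H}

/-- Symmetry and `ε² = -1` cancel the cross terms. Both signs of `ε` give the same graph inner
product, which is what links `Φ` to `Ψ` later. -/
theorem inner_sub_I (hT : IsInClass n T) {ε : ℂ} (hε : ε = I ∨ ε = -I) (x y : T.domain) :
    inner ℂ (T x - ε • (x : H)) (T y - ε • (y : H)) =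
      inner ℂ (T x) (T y) + inner ℂ (x : H) (y : H) := by
  have h := hT.symmetric x y
  rcases hε with rfl | rfl <;>
  · simp only [inner_sub_left, inner_sub_right, inner_smul_left, inner_smul_right, h, map_neg,
      conj_I]
    linear_combination (- inner ℂ (x : H) (y : H)) * I_mul_I

theorem norm_le_sub_I (hT : IsInClass n T) {ε : ℂ} (hε : ε = I ∨ ε = -I) (x : T.domain) :
    ‖(x : H)‖ ^ 2 + ‖T x‖ ^ 2 = ‖T x - ε • (x : H)‖ ^ 2 := by
  have h := hT.inner_sub_I hε x x
  simp only [inner_self_eq_norm_sq_to_K] at h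
  refine Complex.ofReal_injective ?_
  push_cast
  rw [add_comm]
  exact h.symm

/-- `T - εI` is isometric for the graph norm, so convergent images have Cauchy preimages, and the
graph is closed. -/
theorem isClosed_rng (hT : IsInClass n T) [CompleteSpace H] {ε : ℂ} (hε : ε = I ∨ ε = -I) :
    IsClosed (rng T ε : Set H) := by
  refine IsSeqClosed.isClosed fun u y hu hy => ?_
  choose x hx using fun k => mem_rng.1 (hu k)
  have hsub (k l : ℕ) : T (x k - x l) - ε • ((x k - x l : T.domain) : H) = u k - u l := by
    rw [← hx k, ← hx l, T.map_sub, Submodule.coe_sub, smul_sub]; abel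
  have hb (k l : ℕ) : ‖(x k : H) - x l‖ ≤ ‖u k - u l‖ := by
    have := hT.norm_le_sub_I hε (x k - x l)
    rw [hsub] at this
    refine (sq_le_sq₀ (norm_nonneg _) (norm_nonneg _)).1 (by
      rw [← this, Submodule.coe_sub]; nlinarith [sq_nonneg ‖T (x k - x l)‖])
  have hcu := hy.cauchySeq
  have hcx : CauchySeq fun k => (x k : H) := by
    rw [Metric.cauchySeq_iff] at hcu ⊢
    intro δ hδ
    obtain ⟨N, hN⟩ := hcu δ hδ
    refine ⟨N, fun k hk l hl => lt_of_le_of_lt ?_ (hN k hk l hl)⟩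
    rw [dist_eq_norm, dist_eq_norm]
    exact hb k l
  obtain ⟨a, ha⟩ := cauchySeq_tendsto_of_complete hcx
  have hTx : Filter.Tendsto (fun k => T (x k)) Filter.atTop (nhds (y + ε • a)) := by
    refine (hy.add (ha.const_smul ε)).congr fun k => ?_
    rw [← hx k]; abel
  have hmem := hT.closed.mem_of_tendsto (ha.prodMk_nhds hTx)
    (Filter.Eventually.of_forall fun k => ⟨x k, rfl⟩)
  obtain ⟨b, hb'⟩ := hmem
  rw [Prod.mk.injEq] at hb'
  refine mem_rng.2 ⟨b, ?_⟩
  rw [← hb'.2, ← hb'.1]; abel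

end IsInClass

/-- Finite linear combinations of vectors in the ranges of `Γ(w)`, `w` nonreal. -/
def synthesis (Γ : ℂ → K →L[ℂ] H) : ({w : ℂ // w.im ≠ 0} →₀ K) →ₗ[ℂ] H :=
  Finsupp.lsum ℂ fun w : {w : ℂ // w.im ≠ 0} => (Γ w).toLinearMap

theorem synthesis_single (Γ : ℂ → K →L[ℂ] H) (w : {w : ℂ // w.im ≠ 0}) (a : K) :
    synthesis Γ (Finsupp.single w a) = Γ w a := by
  simp [synthesis]

theorem denseRange_synthesis {Γ : ℂ → K →L[ℂ] H}
    (h : (⨆ (w : ℂ) (_ : w.im ≠ 0), LinearMap.range (Γ w).toLinearMap).topologicalClosure = ⊤) :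
    DenseRange (synthesis Γ) := by
  rw [← Submodule.dense_iff_topologicalClosure_eq_top] at h
  refine h.mono ?_
  have hle : (⨆ (w : ℂ) (_ : w.im ≠ 0), LinearMap.range (Γ w).toLinearMap) ≤
      LinearMap.range (synthesis Γ) := by
    refine iSup₂_le fun w hw => ?_
    rintro _ ⟨a, rfl⟩
    exact ⟨Finsupp.single ⟨w, hw⟩ a, synthesis_single Γ ⟨w, hw⟩ a⟩
  exact fun x hx => hle hx

variable [CompleteSpace H] [CompleteSpace H₁] [CompleteSpace H₂] [CompleteSpace K]

/-! ### Kernels and their normalization -/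

open ContinuousLinearMap (adjoint)

@[simp]
theorem kernel_apply (Γ : ℂ → K →L[ℂ] H) (w z : ℂ) (a : K) :
    kernel Γ w z a = adjoint (Γ z) (Γ w a) := rfl

theorem star_kernel (Γ : ℂ → K →L[ℂ] H) (w z : ℂ) : star (kernel Γ w z) = kernel Γ z w := by
  rw [ContinuousLinearMap.star_eq_adjoint, kernel, kernel, ContinuousLinearMap.adjoint_comp,
    ContinuousLinearMap.adjoint_adjoint]

theorem kernel_self_nonneg (Γ : ℂ → K →L[ℂ] H) (w : ℂ) : 0 ≤ kernel Γ w w :=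
  (ContinuousLinearMap.nonneg_iff_isPositive _).2
    (ContinuousLinearMap.isPositive_adjoint_comp_self (Γ w))

/-- The inverse square root of the positive operator `K_w(w)`. -/
def kernelInvSqrt (Γ : ℂ → K →L[ℂ] H) (w : ℂ) : K →L[ℂ] K :=
  kernel Γ w w ^ (-(1 / 2) : ℝ)

theorem star_kernelInvSqrt (Γ : ℂ → K →L[ℂ] H) (w : ℂ) :
    star (kernelInvSqrt Γ w) = kernelInvSqrt Γ w :=
  (IsSelfAdjoint.of_nonneg CFC.rpow_nonneg).star_eq

theorem isUnit_kernelInvSqrt {Γ : ℂ → K →L[ℂ] H} {w : ℂ} (h : IsUnit (kernel Γ w w)) :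
    IsUnit (kernelInvSqrt Γ w) :=
  h.cfcRpow _ (kernel_self_nonneg Γ w)

theorem kernelInvSqrt_mul_self_mul_kernel {Γ : ℂ → K →L[ℂ] H} {w : ℂ}
    (h : IsUnit (kernel Γ w w)) :
    kernelInvSqrt Γ w * kernelInvSqrt Γ w * kernel Γ w w = 1 := by
  have h0 := kernel_self_nonneg Γ w
  have h1 := CFC.rpow_one (kernel Γ w w) h0
  rw [kernelInvSqrt, ← CFC.rpow_add h]
  nth_rw 2 [← h1]
  rw [← CFC.rpow_add h]
  norm_num
  exact CFC.rpow_zero _ h0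

theorem kernelInvSqrt_mul_kernel_mul {Γ : ℂ → K →L[ℂ] H} {w : ℂ} (h : IsUnit (kernel Γ w w)) :
    kernelInvSqrt Γ w * kernel Γ w w * kernelInvSqrt Γ w = 1 := by
  obtain ⟨s, hs⟩ := isUnit_kernelInvSqrt h
  have h1 := kernelInvSqrt_mul_self_mul_kernel h
  rw [← hs, mul_assoc] at h1
  rw [← hs]
  have h2 : (s : K →L[ℂ] K) * kernel Γ w w = ↑s⁻¹ := (s.inv_eq_of_mul_eq_one_right h1).symm
  rw [h2, Units.inv_mul]

theorem kernel_mul_kernelInvSqrt_mul_self {Γ : ℂ → K →L[ℂ] H} {w : ℂ}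
    (h : IsUnit (kernel Γ w w)) :
    kernel Γ w w * kernelInvSqrt Γ w * kernelInvSqrt Γ w = 1 := by
  obtain ⟨s, hs⟩ := isUnit_kernelInvSqrt h
  have h1 := kernelInvSqrt_mul_kernel_mul h
  rw [← hs, mul_assoc] at h1
  rw [← hs, ← s.inv_eq_of_mul_eq_one_right h1, Units.inv_mul]

/-- The function `z ↦ K_w(z) K_w(w)^{-1/2}`, of which `Φ` and `Ψ` are the cases `w = i`
and `w = -i`. -/
def normalizedKernel (Γ : ℂ → K →L[ℂ] H) (w z : ℂ) : K →L[ℂ] K :=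
  kernel Γ w z * kernelInvSqrt Γ w

theorem Phi_eq (Γ : ℂ → K →L[ℂ] H) (z : ℂ) : Phi Γ z = normalizedKernel Γ I z := rfl

theorem Psi_eq (Γ : ℂ → K →L[ℂ] H) (z : ℂ) : Psi Γ z = normalizedKernel Γ (-I) z := rfl

/-- When `K_v(v)` is invertible, the right side is `Γ(z)* P Γ(w)`, with `P` the orthogonal
projection onto `Rng Γ(v)`. -/
theorem normalizedKernel_mul_star (Γ : ℂ → K →L[ℂ] H) (v w z : ℂ) :
    normalizedKernel Γ v z * star (normalizedKernel Γ v w) =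
      kernel Γ v z * (kernelInvSqrt Γ v * kernelInvSqrt Γ v) * kernel Γ w v := by
  simp only [normalizedKernel, star_mul, star_kernel, star_kernelInvSqrt, mul_assoc]

/-! ### The operator as multiplication by the variable -/

namespace IsModel

variable {n : ℕ∞} {T : H →ₗ.[ℂ] H} {Γ : ℂ → K →L[ℂ] H}

theorem mem_orthogonal (hΓ : IsModel T Γ) {w : ℂ} (hw : w.im ≠ 0) (a : K) :
    Γ w a ∈ (rng T w)ᗮ := by
  obtain ⟨e, he⟩ := hΓ.invertible w hw
  exact he a ▸ (e a).2

theorem exists_eq (hΓ : IsModel T Γ) {w : ℂ} (hw : w.im ≠ 0) {y : H} (hy : y ∈ (rng T w)ᗮ) :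
    ∃ a, Γ w a = y := by
  obtain ⟨e, he⟩ := hΓ.invertible w hw
  exact ⟨e.symm ⟨y, hy⟩, by rw [← he]; simp⟩

theorem injective (hΓ : IsModel T Γ) {w : ℂ} (hw : w.im ≠ 0) : Function.Injective (Γ w) := by
  obtain ⟨e, he⟩ := hΓ.invertible w hw
  intro a b hab
  rw [← he, ← he] at hab
  exact e.injective (Subtype.ext hab)

theorem adjoint_sub (hΓ : IsModel T Γ) {z : ℂ} (hz : z.im ≠ 0) (w : ℂ) (x : T.domain) :
    adjoint (Γ z) (T x - w • (x : H)) = (z - w) • adjoint (Γ z) (x : H) := by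
  have h : adjoint (Γ z) (T x - z • (x : H)) = 0 := by
    refine ext_inner_left ℂ fun a => ?_
    rw [ContinuousLinearMap.adjoint_inner_right, inner_zero_right]
    exact (Submodule.mem_orthogonal' _ _).1 (hΓ.mem_orthogonal hz a) _ (mem_rng.2 ⟨x, rfl⟩)
  rw [map_sub, map_smul, sub_eq_zero] at h
  rw [map_sub, map_smul, h, sub_smul]

/-- The kernel of `Γ(ε)*` is the double orthogonal complement of `Rng (T - εI)`, a closed subspace.
-/
theorem mem_rng_of_adjoint_eq_zero (hΓ : IsModel T Γ) (hT : IsInClass n T) {ε : ℂ}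
    (hε : ε = I ∨ ε = -I) {y : H} (hy : adjoint (Γ ε) y = 0) : y ∈ rng T ε := by
  have him : ε.im ≠ 0 := by rcases hε with rfl | rfl <;> simp
  have hc : IsClosed (rng T ε : Set H) := hT.isClosed_rng hε
  have : CompleteSpace (rng T ε) := hc.completeSpace_coe
  rw [← Submodule.orthogonal_orthogonal (rng T ε), Submodule.mem_orthogonal']
  intro u hu
  obtain ⟨a, rfl⟩ := hΓ.exists_eq him hu
  rw [← ContinuousLinearMap.adjoint_inner_left, hy, inner_zero_left]

theorem isUnit_kernel_I (hΓ : IsModel T Γ) {ε : ℂ} (hε : ε = I ∨ ε = -I) :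
    IsUnit (kernel Γ ε ε) := by
  apply hΓ.kernel_invertible
  rcases hε with rfl | rfl <;> simp

theorem continuousOn (hΓ : IsModel T Γ) : ContinuousOn Γ {z : ℂ | z.im ≠ 0} := by
  have h := hΓ.coanalytic.continuousOn.comp (s := {z : ℂ | z.im ≠ 0})
    continuous_conj.continuousOn (fun z hz => by simpa using hz)
  exact h.congr fun z _ => by simp

theorem eq_zero_of_adjoint_eq_zero (hΓ : IsModel T Γ) {y : H}
    (hy : ∀ w : ℂ, w.im ≠ 0 → adjoint (Γ w) y = 0) : y = 0 := by
  have h : y ∈ (⨆ (w : ℂ) (_ : w.im ≠ 0), LinearMap.range (Γ w).toLinearMap)ᗮ := by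
    rw [Submodule.mem_orthogonal]
    intro u hu
    have hle : (⨆ (w : ℂ) (_ : w.im ≠ 0), LinearMap.range (Γ w).toLinearMap) ≤
        (Submodule.span ℂ {y})ᗮ := by
      refine iSup₂_le fun w hw => ?_
      rintro _ ⟨a, rfl⟩
      rw [Submodule.mem_orthogonal_singleton_iff_inner_left]
      change inner ℂ (Γ w a) y = 0
      rw [← ContinuousLinearMap.adjoint_inner_right, hy w hw, inner_zero_right]
    exact (Submodule.mem_orthogonal_singleton_iff_inner_left).1 (hle hu)
  rw [← Submodule.orthogonal_closure, hΓ.span_dense, Submodule.top_orthogonal_eq_bot] at h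
  exact h

/-- The component of `f` orthogonal to the range of `Γ(ε)` lies in `Rng (T - ε I)`. -/
theorem exists_sub_eq (hΓ : IsModel T Γ) (hT : IsInClass n T) {ε : ℂ} (hε : ε = I ∨ ε = -I)
    (f : H) : ∃ g : T.domain, T g - ε • (g : H) =
      f - Γ ε (kernelInvSqrt Γ ε (kernelInvSqrt Γ ε (adjoint (Γ ε) f))) := by
  refine mem_rng.1 (hΓ.mem_rng_of_adjoint_eq_zero hT hε ?_)
  -- `K S² = 1` says that `Γ(ε) S² Γ(ε)*` has the same image as the identity under `Γ(ε)*`.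
  have h := kernel_mul_kernelInvSqrt_mul_self (hΓ.isUnit_kernel_I hε)
  have h' := congrArg (fun A : K →L[ℂ] K => A (adjoint (Γ ε) f)) h
  simp only [mul_apply_eq_comp, kernel_apply, one_apply_eq_self] at h'
  rw [map_sub, h', sub_self]

/-- Both brackets are `Γ(z)*` applied to the part of `Γ(w)u` in `Rng (T ∓ iI)`, namely `(T - i)g`
and `(T + i)g'`. The graph inner product forces `conj (w + i) g = conj (w - i) g'`, and `Γ(z)*`
turns `T` into `z`. -/
theorem kernel_identity (hΓ : IsModel T Γ) (hT : IsInClass n T) {w z : ℂ} (hw : w.im ≠ 0)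
    (hz : z.im ≠ 0) :
    (conj (w + I) * (z + I)) • (kernel Γ w z - Phi Γ z * star (Phi Γ w)) =
      (conj (w - I) * (z - I)) • (kernel Γ w z - Psi Γ z * star (Psi Γ w)) := by
  ext u
  obtain ⟨g, hg⟩ := hΓ.exists_sub_eq hT (.inl rfl) (Γ w u)
  obtain ⟨g', hg'⟩ := hΓ.exists_sub_eq hT (.inr rfl) (Γ w u)
  have key {ε : ℂ} (hε : ε = I ∨ ε = -I) {g : T.domain} (hg : T g - ε • (g : H) =
      Γ w u - Γ ε (kernelInvSqrt Γ ε (kernelInvSqrt Γ ε (adjoint (Γ ε) (Γ w u)))))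
      (k : T.domain) : inner ℂ (T k - ε • (k : H)) (T g - ε • (g : H)) =
        conj (w - ε) * inner ℂ (k : H) (Γ w u) := by
    have him : ε.im ≠ 0 := by rcases hε with rfl | rfl <;> simp
    rw [hg, inner_sub_right, (Submodule.mem_orthogonal _ _).1 (hΓ.mem_orthogonal him _) _
      (mem_rng.2 ⟨k, rfl⟩), sub_zero, ← ContinuousLinearMap.adjoint_inner_left,
      hΓ.adjoint_sub hw, inner_smul_left, ContinuousLinearMap.adjoint_inner_left]
  have hgg : conj (w + I) • (g : H) = conj (w - I) • (g' : H) := by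
    -- By `key`, this difference is orthogonal to the whole domain in the graph inner product, in
    -- particular to itself.
    set k : T.domain := conj (w + I) • g - conj (w - I) • g' with hk
    have h1 := key (.inl rfl) hg k
    have h2 := key (.inr rfl) hg' k
    rw [hT.inner_sub_I (.inr rfl), ← hT.inner_sub_I (.inl rfl), sub_neg_eq_add] at h2
    have h3 : T k - I • (k : H) = conj (w + I) • (T g - I • (g : H)) -
        conj (w - I) • (T g' - I • (g' : H)) := by
      rw [hk, T.map_sub, T.map_smul, T.map_smul]
      simp only [Submodule.coe_sub, Submodule.coe_smul, smul_sub, smul_comm I]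
      abel
    have h4 : inner ℂ (T k - I • (k : H)) (T k - I • (k : H)) = 0 := by
      nth_rw 2 [h3]
      rw [inner_sub_right, inner_smul_right, inner_smul_right, h1, h2]
      ring
    have h5 := hT.norm_le_sub_I (.inl rfl) k
    rw [inner_self_eq_zero.1 h4, norm_zero] at h5
    have h6 : (k : H) = 0 := norm_eq_zero.1 (by nlinarith [sq_nonneg ‖(k : H)‖, sq_nonneg ‖T k‖])
    rw [hk, Submodule.coe_sub, sub_eq_zero] at h6
    exact h6
  have hv (v : ℂ) : (kernel Γ w z - normalizedKernel Γ v z * star (normalizedKernel Γ v w)) u =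
      adjoint (Γ z)
        (Γ w u - Γ v (kernelInvSqrt Γ v (kernelInvSqrt Γ v (adjoint (Γ v) (Γ w u))))) := by
    rw [normalizedKernel_mul_star, map_sub]; rfl
  rw [smul_apply, smul_apply, Phi_eq, Phi_eq, Psi_eq,
    Psi_eq, hv, hv, ← hg, ← hg', hΓ.adjoint_sub hz, hΓ.adjoint_sub hz, smul_smul, smul_smul,
    sub_neg_eq_add]
  have h := congrArg (fun x => ((z + I) * (z - I)) • adjoint (Γ z) x) hgg
  simp only [map_smul, smul_smul] at h
  convert h using 2 <;> ring

/-- The operator is multiplication by the variable with its maximal domain. -/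
theorem adjoint_eq_smul_iff (hΓ : IsModel T Γ) (hT : IsInClass n T) (x y : H) :
    (∀ w : ℂ, w.im ≠ 0 → adjoint (Γ w) y = w • adjoint (Γ w) x) ↔
      ∃ g : T.domain, (g : H) = x ∧ T g = y := by
  constructor
  · intro h
    -- The candidate `g` solves `(T - i)g = y - ix`. The transforms of `g` and `x` agree off `i`,
    -- then at `i` by continuity.
    obtain ⟨g, hg⟩ := mem_rng.1 (hΓ.mem_rng_of_adjoint_eq_zero hT (.inl rfl) (y := y - I • x)
      (by rw [map_sub, map_smul, h I (by simp), sub_self]))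
    have h1 (w : ℂ) (hw : w.im ≠ 0) (hwI : w ≠ I) : adjoint (Γ w) ((g : H) - x) = 0 := by
      have h2 := hΓ.adjoint_sub hw I g
      rw [hg, map_sub, map_smul, h w hw, ← sub_smul, eq_comm, ← sub_eq_zero, ← smul_sub,
        ← map_sub] at h2
      exact (smul_eq_zero.1 h2).resolve_left (sub_ne_zero.2 hwI)
    have hcont : ContinuousAt (fun w => adjoint (Γ w) ((g : H) - x)) I := by
      have : ContinuousAt Γ I := hΓ.continuousOn.continuousAt
        ((isOpen_ne_fun continuous_im continuous_const).mem_nhds (by simp))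
      exact ((ContinuousLinearMap.adjoint.continuous.continuousAt.comp this).clm_apply
        continuousAt_const)
    have h2 : adjoint (Γ I) ((g : H) - x) = 0 := by
      refine tendsto_nhds_unique (hcont.tendsto.mono_left nhdsWithin_le_nhds)
        ((tendsto_const_nhds (f := nhdsWithin I {I}ᶜ)).congr' ?_)
      filter_upwards [self_mem_nhdsWithin, mem_nhdsWithin_of_mem_nhds
        ((isOpen_ne_fun continuous_im continuous_const).mem_nhds (by simp : I.im ≠ 0))] with w hw hw'
      exact (h1 w hw' hw).symm
    have h3 : (g : H) - x = 0 := hΓ.eq_zero_of_adjoint_eq_zero fun w hw => by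
      by_cases hwI : w = I
      · rw [hwI, h2]
      · exact h1 w hw hwI
    rw [sub_eq_zero] at h3
    refine ⟨g, h3, ?_⟩
    rwa [h3, sub_left_inj] at hg
  · rintro ⟨g, rfl, rfl⟩ w hw
    simpa using hΓ.adjoint_sub hw 0 g

end IsModel

/-! ### Functions attached to a model -/

theorem isOpen_nonreal : IsOpen {z : ℂ | z.im ≠ 0} := isOpen_ne_fun continuous_im continuous_const

theorem isOpen_upperHalfPlane : IsOpen {z : ℂ | 0 < z.im} :=
  isOpen_lt continuous_const continuous_im

theorem isOpen_lowerHalfPlane : IsOpen {z : ℂ | z.im < 0} :=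
  isOpen_lt continuous_im continuous_const

theorem _root_.ContinuousAt.ringInverse {X R : Type*} [TopologicalSpace X] [NormedRing R]
    [HasSummableGeomSeries R] {f : X → R} {x : X} (hf : ContinuousAt f x) (h : IsUnit (f x)) :
    ContinuousAt (fun y => Ring.inverse (f y)) x := by
  obtain ⟨u, hu⟩ := h
  have := NormedRing.inverse_continuousAt u
  rw [hu] at this
  exact ContinuousAt.comp (f := f) this hf

namespace IsModel

variable {n : ℕ∞} {T : H →ₗ.[ℂ] H} {Γ : ℂ → K →L[ℂ] H}

theorem continuousAt_kernel (hΓ : IsModel T Γ) (w : ℂ) {z : ℂ} (hz : z.im ≠ 0) :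
    ContinuousAt (kernel Γ w) z := by
  have : ContinuousAt Γ z := hΓ.continuousOn.continuousAt (isOpen_nonreal.mem_nhds hz)
  exact (ContinuousLinearMap.adjoint.continuous.continuousAt.comp this).clm_comp
    continuousAt_const

theorem continuousAt_normalizedKernel (hΓ : IsModel T Γ) (w : ℂ) {z : ℂ} (hz : z.im ≠ 0) :
    ContinuousAt (normalizedKernel Γ w) z :=
  (hΓ.continuousAt_kernel w hz).mul continuousAt_const

theorem isUnit_Phi (hΓ : IsModel T Γ) {z : ℂ} (hz : 0 < z.im) : IsUnit (Phi Γ z) :=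
  (hΓ.kernel_invertible I z (.inl ⟨by simp, hz⟩)).mul
    (isUnit_kernelInvSqrt (hΓ.isUnit_kernel_I (.inl rfl)))

theorem isUnit_Psi (hΓ : IsModel T Γ) {z : ℂ} (hz : z.im < 0) : IsUnit (Psi Γ z) :=
  (hΓ.kernel_invertible (-I) z (.inr ⟨by simp, hz⟩)).mul
    (isUnit_kernelInvSqrt (hΓ.isUnit_kernel_I (.inr rfl)))

theorem continuousAt_Phi (hΓ : IsModel T Γ) {z : ℂ} (hz : z.im ≠ 0) : ContinuousAt (Phi Γ) z :=
  hΓ.continuousAt_normalizedKernel I hz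

theorem continuousAt_Psi (hΓ : IsModel T Γ) {z : ℂ} (hz : z.im ≠ 0) : ContinuousAt (Psi Γ) z :=
  hΓ.continuousAt_normalizedKernel (-I) hz

theorem continuousAt_inverse_Phi_mul_Psi (hΓ : IsModel T Γ) {z : ℂ} (hz : 0 < z.im) :
    ContinuousAt (fun z => Ring.inverse (Phi Γ z) * Psi Γ z) z :=
  ((hΓ.continuousAt_Phi hz.ne').ringInverse (hΓ.isUnit_Phi hz)).mul (hΓ.continuousAt_Psi hz.ne')

/-- At `w = z̄` both scalar factors of `kernel_identity` equal `(z - i)(z + i)`. At `z = ±i` they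
vanish, and both sides reduce to the same kernel value by normalization. -/
theorem Phi_mul_star_conj (hΓ : IsModel T Γ) (hT : IsInClass n T) {z : ℂ} (hz : z.im ≠ 0) :
    Phi Γ z * star (Phi Γ (conj z)) = Psi Γ z * star (Psi Γ (conj z)) := by
  have hl {ε : ℂ} (hε : ε = I ∨ ε = -I) (w : ℂ) :
      normalizedKernel Γ ε ε * star (normalizedKernel Γ ε w) = kernel Γ w ε := by
    rw [normalizedKernel_mul_star, ← mul_assoc,
      kernel_mul_kernelInvSqrt_mul_self (hΓ.isUnit_kernel_I hε), one_mul]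
  have hr {ε : ℂ} (hε : ε = I ∨ ε = -I) (w : ℂ) :
      normalizedKernel Γ ε w * star (normalizedKernel Γ ε ε) = kernel Γ ε w := by
    rw [normalizedKernel_mul_star, mul_assoc,
      kernelInvSqrt_mul_self_mul_kernel (hΓ.isUnit_kernel_I hε), mul_one]
  simp only [Phi_eq, Psi_eq]
  by_cases h1 : z = I
  · rw [h1, conj_I, hl (.inl rfl), hr (.inr rfl)]
  by_cases h2 : z = -I
  · rw [h2, map_neg, conj_I, neg_neg, hl (.inr rfl), hr (.inl rfl)]
  have h := hΓ.kernel_identity hT (w := conj z) (z := z) (by simpa using hz) hz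
  simp only [map_add, map_sub, conj_conj, conj_I, sub_neg_eq_add, ← sub_eq_add_neg] at h
  rw [mul_comm (z + I)] at h
  have h3 := smul_right_injective (K →L[ℂ] K)
    (mul_ne_zero (sub_ne_zero.2 h1) (fun h => h2 (eq_neg_of_add_eq_zero_left h))) h
  simpa [Phi_eq, Psi_eq] using h3

/-- Expresses `Φ` below the real axis through `Φ⁻¹Ψ` above it, so the hypothesis on `V` in the upper
half plane suffices. -/
theorem Phi_eq_Psi_mul_star (hΓ : IsModel T Γ) (hT : IsInClass n T) {z : ℂ} (hz : z.im < 0) :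
    Phi Γ z = Psi Γ z * star (Ring.inverse (Phi Γ (conj z)) * Psi Γ (conj z)) := by
  have hu : IsUnit (Phi Γ (conj z)) := hΓ.isUnit_Phi (by simpa using hz)
  have h1 : star (Phi Γ (conj z)) * star (Ring.inverse (Phi Γ (conj z))) = 1 := by
    rw [← star_mul, Ring.inverse_mul_cancel _ hu, star_one]
  rw [star_mul, ← mul_assoc, ← hΓ.Phi_mul_star_conj hT hz.ne, mul_assoc, h1, mul_one]

end IsModel

/-! ### Unitarily equivalent operators -/

section Forward

variable {n : ℕ∞} {T₁ : H₁ →ₗ.[ℂ] H₁} {T₂ : H₂ →ₗ.[ℂ] H₂}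
  {Γ₁ : ℂ → K →L[ℂ] H₁} {Γ₂ : ℂ → K →L[ℂ] H₂}

/-- `U` carries `Rng (T₁ - wI)ᗮ` into `Rng (T₂ - wI)ᗮ`, which `Γ₂(w)` parametrizes bijectively. -/
theorem exists_comp_eq (U : H₁ ≃ₗᵢ[ℂ] H₂) (hdom : ∀ x : H₁, U x ∈ T₂.domain → x ∈ T₁.domain)
    (hU : ∀ (x : T₁.domain) (y : T₂.domain), U (x : H₁) = (y : H₂) → U (T₁ x) = T₂ y)
    (hΓ₁ : IsModel T₁ Γ₁) (hΓ₂ : IsModel T₂ Γ₂) {w : ℂ} (hw : w.im ≠ 0) :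
    ∃ g : K →L[ℂ] K, ∀ a, U (Γ₁ w a) = Γ₂ w (g a) := by
  have hmem (a : K) : U (Γ₁ w a) ∈ (rng T₂ w)ᗮ := by
    rw [Submodule.mem_orthogonal]
    intro u hu
    obtain ⟨y, rfl⟩ := mem_rng.1 hu
    have hx : U.symm (y : H₂) ∈ T₁.domain := hdom _ (by simp)
    have h := hU ⟨_, hx⟩ y (by simp)
    have h' : T₂ y - w • (y : H₂) = U (T₁ ⟨_, hx⟩ - w • U.symm (y : H₂)) := by
      rw [map_sub, h, map_smul, U.apply_symm_apply]
    rw [h', U.inner_map_map]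
    exact (Submodule.mem_orthogonal _ _).1 (hΓ₁.mem_orthogonal hw a) _
      (mem_rng.2 ⟨⟨_, hx⟩, rfl⟩)
  obtain ⟨e, he⟩ := hΓ₂.invertible w hw
  refine ⟨e.symm.toContinuousLinearMap ∘L
    ((U.toContinuousLinearEquiv.toContinuousLinearMap ∘L Γ₁ w).codRestrict _ hmem), fun a => ?_⟩
  rw [← he]
  simp only [ContinuousLinearMap.comp_apply, ContinuousLinearEquiv.coe_coe,
    ContinuousLinearEquiv.apply_symm_apply]
  rfl

theorem exists_isUnit_comp_eq (U : H₁ ≃ₗᵢ[ℂ] H₂)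
    (hdom : ∀ x : H₁, x ∈ T₁.domain ↔ U x ∈ T₂.domain)
    (hU : ∀ (x : T₁.domain) (y : T₂.domain), U (x : H₁) = (y : H₂) → U (T₁ x) = T₂ y)
    (hΓ₁ : IsModel T₁ Γ₁) (hΓ₂ : IsModel T₂ Γ₂) {w : ℂ} (hw : w.im ≠ 0) :
    ∃ g : K →L[ℂ] K, IsUnit g ∧ ∀ a, U (Γ₁ w a) = Γ₂ w (g a) := by
  obtain ⟨g, hg⟩ := exists_comp_eq U (fun x => (hdom x).2) hU hΓ₁ hΓ₂ hw
  obtain ⟨g', hg'⟩ := exists_comp_eq U.symm (fun x hx => by simpa using (hdom _).1 hx)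
    (fun y x hxy => by
      rw [← hU x y (by rw [← hxy, U.apply_symm_apply]), U.symm_apply_apply]) hΓ₂ hΓ₁ hw
  refine ⟨g, ⟨⟨g, g', ?_, ?_⟩, rfl⟩, hg⟩
  · ext a
    apply hΓ₂.injective hw
    change Γ₂ w (g (g' a)) = Γ₂ w a
    rw [← hg, ← hg', U.apply_symm_apply]
  · ext a
    apply hΓ₁.injective hw
    change Γ₁ w (g' (g a)) = Γ₁ w a
    rw [← hg', ← hg, U.symm_apply_apply]

theorem exists_unitary_normalizedKernel {g : ℂ → K →L[ℂ] K} {w : ℂ} (hw : w.im ≠ 0)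
    (hg : ∀ w : ℂ, w.im ≠ 0 → IsUnit (g w))
    (hK : ∀ w z : ℂ, w.im ≠ 0 → z.im ≠ 0 →
      kernel Γ₁ w z = star (g z) * kernel Γ₂ w z * g w)
    (h₁ : IsUnit (kernel Γ₁ w w)) (h₂ : IsUnit (kernel Γ₂ w w)) :
    ∃ A : unitary (K →L[ℂ] K), ∀ z : ℂ, z.im ≠ 0 →
      normalizedKernel Γ₁ w z = star (g z) * normalizedKernel Γ₂ w z * (A : K →L[ℂ] K) := by
  set S₁ := kernelInvSqrt Γ₁ w with hS₁
  set S₂ := kernelInvSqrt Γ₂ w with hS₂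
  -- Here `S₂ K₂ = S₂⁻¹`, so `A = S₂⁻¹ g(w) S₁`, as the factorization demands; `A* A = S₁ K₁ S₁ =
  -- 1`.
  set A := S₂ * kernel Γ₂ w w * g w * S₁ with hA
  have hu : IsUnit A := (((isUnit_kernelInvSqrt h₂).mul h₂).mul (hg w hw)).mul
    (isUnit_kernelInvSqrt h₁)
  have h3 : S₁ * kernel Γ₁ w w * S₁ = 1 := kernelInvSqrt_mul_kernel_mul h₁
  have h4 : kernel Γ₂ w w * S₂ * S₂ = 1 := kernel_mul_kernelInvSqrt_mul_self h₂
  have h5 : S₂ * S₂ * kernel Γ₂ w w = 1 := kernelInvSqrt_mul_self_mul_kernel h₂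
  have hAA : star A * A = 1 := by
    calc star A * A
        = S₁ * (star (g w) * ((kernel Γ₂ w w * S₂ * S₂) * kernel Γ₂ w w) * g w) * S₁ := by
          simp only [hA, star_mul, star_kernel, hS₁, hS₂, star_kernelInvSqrt, mul_assoc]
      _ = 1 := by rw [h4, one_mul, ← hK w w hw hw, h3]
  refine ⟨⟨A, hu.mem_unitary_of_star_mul_self hAA⟩, fun z hz => ?_⟩
  calc normalizedKernel Γ₁ w z = star (g z) * kernel Γ₂ w z * g w * S₁ := by
        rw [normalizedKernel, hK w z hw hz]
    _ = star (g z) * kernel Γ₂ w z * (S₂ * S₂ * kernel Γ₂ w w) * g w * S₁ := by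
        rw [h5, mul_one]
    _ = _ := by simp only [normalizedKernel, hA, ← hS₂, mul_assoc]

theorem exists_charFun_eq (hT : UnitarilyEquivalent T₁ T₂)
    (hΓ₁ : IsModel T₁ Γ₁) (hΓ₂ : IsModel T₂ Γ₂) :
    ∃ R Q : unitary (K →L[ℂ] K), ∀ z : ℂ, 0 < z.im →
      charFun Γ₁ z = (R : K →L[ℂ] K) * charFun Γ₂ z * (Q : K →L[ℂ] K) := by
  obtain ⟨U, hdom, hU⟩ := hT
  have hex (w : ℂ) : ∃ g : K →L[ℂ] K, w.im ≠ 0 → IsUnit g ∧ ∀ a, U (Γ₁ w a) = Γ₂ w (g a) := by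
    by_cases hw : w.im ≠ 0
    · obtain ⟨g, hg⟩ := exists_isUnit_comp_eq U hdom hU hΓ₁ hΓ₂ hw
      exact ⟨g, fun _ => hg⟩
    · exact ⟨0, fun h => absurd h hw⟩
  choose g hg using hex
  have hK (w z : ℂ) (hw : w.im ≠ 0) (hz : z.im ≠ 0) :
      kernel Γ₁ w z = star (g z) * kernel Γ₂ w z * g w := by
    ext a
    refine ext_inner_left ℂ fun b => ?_
    change inner ℂ b (adjoint (Γ₁ z) (Γ₁ w a)) =
      inner ℂ b (adjoint (g z) (adjoint (Γ₂ z) (Γ₂ w (g w a))))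
    rw [ContinuousLinearMap.adjoint_inner_right, ContinuousLinearMap.adjoint_inner_right,
      ContinuousLinearMap.adjoint_inner_right, ← (hg w hw).2, ← (hg z hz).2, U.inner_map_map]
  obtain ⟨A, hA⟩ := exists_unitary_normalizedKernel (w := I) (by simp) (fun w hw => (hg w hw).1)
    hK (hΓ₁.isUnit_kernel_I (.inl rfl)) (hΓ₂.isUnit_kernel_I (.inl rfl))
  obtain ⟨B, hB⟩ := exists_unitary_normalizedKernel (w := -I) (by simp) (fun w hw => (hg w hw).1)
    hK (hΓ₁.isUnit_kernel_I (.inr rfl)) (hΓ₂.isUnit_kernel_I (.inr rfl))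
  refine ⟨star A, B, fun z hz => ?_⟩
  have h1 := hΓ₁.isUnit_Phi hz
  have h2 := hΓ₂.isUnit_Phi hz
  rw [charFun, charFun, mul_smul_comm, smul_mul_assoc]
  congr 1
  rw [Ring.inverse_mul_eq_iff_eq_mul _ _ _ h1]
  calc Psi Γ₁ z = star (g z) * (Phi Γ₂ z * Ring.inverse (Phi Γ₂ z)) * Psi Γ₂ z * B := by
        rw [Ring.mul_inverse_cancel _ h2, mul_one, Psi_eq, Psi_eq, hB z hz.ne']
    _ = star (g z) * Phi Γ₂ z * (A * star A : K →L[ℂ] K) *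
          (Ring.inverse (Phi Γ₂ z) * Psi Γ₂ z) * B := by
        rw [Unitary.coe_star, Unitary.mul_star_self_of_mem A.2]; simp only [mul_one, mul_assoc]
    _ = _ := by
        rw [Phi_eq Γ₁, hA z hz.ne', Phi_eq Γ₂, Unitary.coe_star]; simp only [mul_assoc]

end Forward

/-! ### Operators with equivalent characteristic functions -/

section Backward

variable {n : ℕ∞} {T₁ : H₁ →ₗ.[ℂ] H₁} {T₂ : H₂ →ₗ.[ℂ] H₂}
  {Γ₁ : ℂ → K →L[ℂ] H₁} {Γ₂ : ℂ → K →L[ℂ] H₂}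

/-- The Blaschke factor vanishes only at `i` in the upper half plane; continuity fills in that
point. -/
theorem inverse_Phi_mul_Psi_eq (hΓ₁ : IsModel T₁ Γ₁) (hΓ₂ : IsModel T₂ Γ₂) {R Q : K →L[ℂ] K}
    (h : ∀ z : ℂ, 0 < z.im → charFun Γ₁ z = R * charFun Γ₂ z * Q) {z : ℂ} (hz : 0 < z.im) :
    Ring.inverse (Phi Γ₁ z) * Psi Γ₁ z = R * (Ring.inverse (Phi Γ₂ z) * Psi Γ₂ z) * Q := by
  have hne {z : ℂ} (hz : 0 < z.im) (hzI : z ≠ I) :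
      Ring.inverse (Phi Γ₁ z) * Psi Γ₁ z = R * (Ring.inverse (Phi Γ₂ z) * Psi Γ₂ z) * Q := by
    have h1 := h z hz
    rw [charFun, charFun, mul_smul_comm, smul_mul_assoc] at h1
    refine smul_right_injective (K →L[ℂ] K) (div_ne_zero (sub_ne_zero.2 hzI) fun h2 => ?_) h1
    have := congrArg im h2
    simp at this
    linarith
  by_cases hzI : z = I
  · subst hzI
    refine tendsto_nhds_unique ((hΓ₁.continuousAt_inverse_Phi_mul_Psi hz).tendsto.mono_left
      nhdsWithin_le_nhds) (Filter.Tendsto.congr' ?_ (((hΓ₂.continuousAt_inverse_Phi_mul_Psi hz).tendsto.mono_left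
        (nhdsWithin_le_nhds (s := {I}ᶜ))).const_mul R |>.mul_const Q))
    filter_upwards [self_mem_nhdsWithin, mem_nhdsWithin_of_mem_nhds
      (isOpen_upperHalfPlane.mem_nhds hz)] with w hw hw'
    exact (hne hw' hw).symm
  · exact hne hz hzI

/-- The transition function between the kernels of two models. -/
def transition (Γ₁ : ℂ → K →L[ℂ] H₁) (Γ₂ : ℂ → K →L[ℂ] H₂) (R Q : K →L[ℂ] K) (z : ℂ) :
    K →L[ℂ] K :=
  -- Each branch divides by the factor known to be invertible there; real points play no role.
  if 0 < z.im then Phi Γ₁ z * R * Ring.inverse (Phi Γ₂ z)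
  else Psi Γ₁ z * star Q * Ring.inverse (Psi Γ₂ z)

theorem transition_of_pos (R Q : K →L[ℂ] K) {z : ℂ} (hz : 0 < z.im) :
    transition Γ₁ Γ₂ R Q z = Phi Γ₁ z * R * Ring.inverse (Phi Γ₂ z) := if_pos hz

theorem transition_of_neg (R Q : K →L[ℂ] K) {z : ℂ} (hz : z.im < 0) :
    transition Γ₁ Γ₂ R Q z = Psi Γ₁ z * star Q * Ring.inverse (Psi Γ₂ z) := if_neg hz.not_gt

theorem continuousAt_transition (hΓ₁ : IsModel T₁ Γ₁) (hΓ₂ : IsModel T₂ Γ₂) (R Q : K →L[ℂ] K)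
    {z : ℂ} (hz : z.im ≠ 0) : ContinuousAt (transition Γ₁ Γ₂ R Q) z := by
  rcases hz.lt_or_gt with h | h
  · refine ContinuousAt.congr (f := fun z => Psi Γ₁ z * star Q * Ring.inverse (Psi Γ₂ z))
      (((hΓ₁.continuousAt_Psi hz).mul continuousAt_const).mul
        ((hΓ₂.continuousAt_Psi hz).ringInverse (hΓ₂.isUnit_Psi h))) ?_
    filter_upwards [isOpen_lowerHalfPlane.mem_nhds h] with w hw
    exact (transition_of_neg R Q hw).symm
  · refine ContinuousAt.congr (f := fun z => Phi Γ₁ z * R * Ring.inverse (Phi Γ₂ z))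
      (((hΓ₁.continuousAt_Phi hz).mul continuousAt_const).mul
        ((hΓ₂.continuousAt_Phi hz).ringInverse (hΓ₂.isUnit_Phi h))) ?_
    filter_upwards [isOpen_upperHalfPlane.mem_nhds h] with w hw
    exact (transition_of_pos R Q hw).symm

theorem isUnit_transition (hΓ₁ : IsModel T₁ Γ₁) (hΓ₂ : IsModel T₂ Γ₂)
    (R Q : unitary (K →L[ℂ] K)) {z : ℂ} (hz : z.im ≠ 0) :
    IsUnit (transition Γ₁ Γ₂ (R : K →L[ℂ] K) Q z) := by
  rcases hz.lt_or_gt with h | h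
  · rw [transition_of_neg _ _ h]
    exact ((hΓ₁.isUnit_Psi h).mul (Unitary.toUnits (star Q)).isUnit).mul
      (hΓ₂.isUnit_Psi h).ringInverse
  · rw [transition_of_pos _ _ h]
    exact ((hΓ₁.isUnit_Phi h).mul (Unitary.toUnits R).isUnit).mul (hΓ₂.isUnit_Phi h).ringInverse

theorem Phi_and_Psi_eq_transition_mul (hT₁ : IsInClass n T₁) (hT₂ : IsInClass n T₂)
    (hΓ₁ : IsModel T₁ Γ₁) (hΓ₂ : IsModel T₂ Γ₂) (R Q : unitary (K →L[ℂ] K))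
    (h : ∀ z : ℂ, 0 < z.im →
      charFun Γ₁ z = (R : K →L[ℂ] K) * charFun Γ₂ z * (Q : K →L[ℂ] K))
    {z : ℂ} (hz : z.im ≠ 0) :
    Phi Γ₁ z = transition Γ₁ Γ₂ (R : K →L[ℂ] K) Q z * Phi Γ₂ z * star (R : K →L[ℂ] K) ∧
      Psi Γ₁ z = transition Γ₁ Γ₂ (R : K →L[ℂ] K) Q z * Psi Γ₂ z * (Q : K →L[ℂ] K) := by
  have hR := Unitary.mul_star_self_of_mem R.2
  have hQ := Unitary.star_mul_self_of_mem Q.2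
  rcases hz.lt_or_gt with h0 | h0
  · rw [transition_of_neg _ _ h0]
    have hP : Psi Γ₁ z * star (Q : K →L[ℂ] K) * Ring.inverse (Psi Γ₂ z) * Psi Γ₂ z =
        Psi Γ₁ z * star (Q : K →L[ℂ] K) := by
      rw [mul_assoc, Ring.inverse_mul_cancel _ (hΓ₂.isUnit_Psi h0), mul_one]
    refine ⟨?_, by rw [hP, mul_assoc, hQ, mul_one]⟩
    have hc : 0 < (conj z).im := by simpa using h0
    rw [hΓ₁.Phi_eq_Psi_mul_star hT₁ h0, inverse_Phi_mul_Psi_eq hΓ₁ hΓ₂ h hc,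
      hΓ₂.Phi_eq_Psi_mul_star hT₂ h0, star_mul (_ * _),
      star_mul (R : K →L[ℂ] K), ← mul_assoc _ (Psi Γ₂ z), hP]
    simp only [mul_assoc]
  · rw [transition_of_pos _ _ h0]
    have hP : Phi Γ₁ z * R * Ring.inverse (Phi Γ₂ z) * Phi Γ₂ z = Phi Γ₁ z * R := by
      rw [mul_assoc, Ring.inverse_mul_cancel _ (hΓ₂.isUnit_Phi h0), mul_one]
    refine ⟨by rw [hP, mul_assoc, hR, mul_one], ?_⟩
    have h1 := (Ring.inverse_mul_eq_iff_eq_mul _ _ _ (hΓ₁.isUnit_Phi h0)).1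
      (inverse_Phi_mul_Psi_eq hΓ₁ hΓ₂ h h0)
    rw [h1]
    simp only [mul_assoc]

theorem kernel_eq_transition_mul (hT₁ : IsInClass n T₁) (hT₂ : IsInClass n T₂)
    (hΓ₁ : IsModel T₁ Γ₁) (hΓ₂ : IsModel T₂ Γ₂) (R Q : unitary (K →L[ℂ] K))
    (h : ∀ z : ℂ, 0 < z.im →
      charFun Γ₁ z = (R : K →L[ℂ] K) * charFun Γ₂ z * (Q : K →L[ℂ] K))
    {w z : ℂ} (hw : w.im ≠ 0) (hz : z.im ≠ 0) :
    kernel Γ₁ w z = transition Γ₁ Γ₂ (R : K →L[ℂ] K) Q z * kernel Γ₂ w z *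
      star (transition Γ₁ Γ₂ (R : K →L[ℂ] K) Q w) := by
  set G := transition Γ₁ Γ₂ (R : K →L[ℂ] K) Q with hG
  have hR := Unitary.star_mul_self_of_mem R.2
  have hQ := Unitary.mul_star_self_of_mem Q.2
  have hne {z : ℂ} (hz : z.im ≠ 0) (hzw : z ≠ conj w) :
      kernel Γ₁ w z = G z * kernel Γ₂ w z * star (G w) := by
    have hid₁ := hΓ₁.kernel_identity hT₁ hw hz
    have hid₂ := congrArg (fun A => G z * A * star (G w)) (hΓ₂.kernel_identity hT₂ hw hz)
    have hPhi : Phi Γ₁ z * star (Phi Γ₁ w) = G z * (Phi Γ₂ z * star (Phi Γ₂ w)) * star (G w) := by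
      rw [(Phi_and_Psi_eq_transition_mul hT₁ hT₂ hΓ₁ hΓ₂ R Q h hz).1,
        (Phi_and_Psi_eq_transition_mul hT₁ hT₂ hΓ₁ hΓ₂ R Q h hw).1, star_mul, star_star,
        mul_assoc, ← mul_assoc (star (R : K →L[ℂ] K)), hR, one_mul, star_mul]
      simp only [mul_assoc, hG]
    have hPsi : Psi Γ₁ z * star (Psi Γ₁ w) = G z * (Psi Γ₂ z * star (Psi Γ₂ w)) * star (G w) := by
      rw [(Phi_and_Psi_eq_transition_mul hT₁ hT₂ hΓ₁ hΓ₂ R Q h hz).2,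
        (Phi_and_Psi_eq_transition_mul hT₁ hT₂ hΓ₁ hΓ₂ R Q h hw).2, star_mul,
        mul_assoc, ← mul_assoc (Q : K →L[ℂ] K), hQ, one_mul, star_mul]
      simp only [mul_assoc, hG]
    have hc : conj (w + I) * (z + I) - conj (w - I) * (z - I) ≠ 0 := by
      have : conj (w + I) * (z + I) - conj (w - I) * (z - I) = 2 * I * (conj w - z) := by
        simp only [map_add, map_sub, conj_I]; ring
      rw [this]
      exact mul_ne_zero (by simp) (sub_ne_zero.2 hzw.symm)
    generalize conj (w + I) * (z + I) = c at hid₁ hid₂ hc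
    generalize conj (w - I) * (z - I) = d at hid₁ hid₂ hc
    simp only [mul_smul_comm, smul_mul_assoc, mul_sub, sub_mul, smul_sub] at hid₂
    rw [smul_sub, smul_sub, hPhi, hPsi] at hid₁
    refine smul_right_injective (K →L[ℂ] K) hc ?_
    simp only [sub_smul]
    rw [sub_eq_sub_iff_sub_eq_sub.1 hid₁, ← sub_eq_sub_iff_sub_eq_sub.1 hid₂]
  -- The scalar `2i(w̄ - z)` vanishes here, so the identity is obtained as a limit in `z`.
  by_cases hzw : z = conj w
  · refine tendsto_nhds_unique ((hΓ₁.continuousAt_kernel w hz).tendsto.mono_left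
      (nhdsWithin_le_nhds (s := {z}ᶜ))) (Filter.Tendsto.congr' ?_
        ((((continuousAt_transition hΓ₁ hΓ₂ _ _ hz).mul
          (hΓ₂.continuousAt_kernel w hz)).mul continuousAt_const).tendsto.mono_left
            nhdsWithin_le_nhds))
    filter_upwards [self_mem_nhdsWithin, mem_nhdsWithin_of_mem_nhds
      (isOpen_nonreal.mem_nhds hz)] with v hv hv'
    exact (hne hv' (hzw ▸ hv)).symm
  · exact hne hz hzw

end Backward

/-! ### Recovering the operator from its kernel -/

theorem inner_synthesis_eq {Γ₁ : ℂ → K →L[ℂ] H₁} {Γ₂ : ℂ → K →L[ℂ] H₂}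
    (h : ∀ w z : ℂ, w.im ≠ 0 → z.im ≠ 0 → kernel Γ₁ w z = kernel Γ₂ w z)
    (x y : {w : ℂ // w.im ≠ 0} →₀ K) :
    inner ℂ (synthesis Γ₁ x) (synthesis Γ₁ y) = inner ℂ (synthesis Γ₂ x) (synthesis Γ₂ y) := by
  induction x using Finsupp.induction_linear with
  | zero => simp
  | add x x' hx hx' => simp only [map_add, inner_add_left, hx, hx']
  | single z a =>
    induction y using Finsupp.induction_linear with
    | zero => simp
    | add y y' hy hy' => simp only [map_add, inner_add_right, hy, hy']
    | single w b =>
      simp only [synthesis_single, ← ContinuousLinearMap.adjoint_inner_right, ← kernel_apply,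
        h w z w.2 z.2]

/-- The kernel is the Gram matrix of the vectors `Γ(w)a`, whose span is dense. -/
theorem exists_isometry {Γ₁ : ℂ → K →L[ℂ] H₁} {Γ₂ : ℂ → K →L[ℂ] H₂}
    (h₁ : (⨆ (w : ℂ) (_ : w.im ≠ 0), LinearMap.range (Γ₁ w).toLinearMap).topologicalClosure = ⊤)
    (h₂ : (⨆ (w : ℂ) (_ : w.im ≠ 0), LinearMap.range (Γ₂ w).toLinearMap).topologicalClosure = ⊤)
    (h : ∀ w z : ℂ, w.im ≠ 0 → z.im ≠ 0 → kernel Γ₁ w z = kernel Γ₂ w z) :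
    ∃ U : H₁ ≃ₗᵢ[ℂ] H₂, ∀ w : ℂ, w.im ≠ 0 → ∀ a, U (Γ₁ w a) = Γ₂ w a := by
  have hn (x : {w : ℂ // w.im ≠ 0} →₀ K) : ‖synthesis Γ₂ x‖ = ‖synthesis Γ₁ x‖ := by
    rw [@norm_eq_sqrt_re_inner ℂ, @norm_eq_sqrt_re_inner ℂ, inner_synthesis_eq h]
  refine ⟨(LinearEquiv.refl ℂ _).extendOfIsometry (synthesis Γ₁) (synthesis Γ₂)
    (denseRange_synthesis h₁) (denseRange_synthesis h₂) hn, fun w hw a => ?_⟩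
  rw [← synthesis_single Γ₁ ⟨w, hw⟩, ← synthesis_single Γ₂ ⟨w, hw⟩]
  exact LinearEquiv.extendOfIsometry_eq _ _ _ _ _ hn _

variable {n : ℕ∞} {T₁ : H₁ →ₗ.[ℂ] H₁} {T₂ : H₂ →ₗ.[ℂ] H₂}
  {Γ₁ : ℂ → K →L[ℂ] H₁} {Γ₂ : ℂ → K →L[ℂ] H₂}

/-- Transforms of `x` and `Ux` differ at each `w` by the injective linear map `g(w)*`, so the
multiplication relation describing the graph passes through `U`. -/
theorem unitarilyEquivalent_of_comp_eq (hT₁ : IsInClass n T₁) (hT₂ : IsInClass n T₂)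
    (hΓ₁ : IsModel T₁ Γ₁) (hΓ₂ : IsModel T₂ Γ₂) (U : H₁ ≃ₗᵢ[ℂ] H₂) {g : ℂ → K →L[ℂ] K}
    (hg : ∀ w : ℂ, w.im ≠ 0 → IsUnit (g w))
    (hU : ∀ w : ℂ, w.im ≠ 0 → ∀ a, U (Γ₁ w a) = Γ₂ w (g w a)) :
    UnitarilyEquivalent T₁ T₂ := by
  have hadj {w : ℂ} (hw : w.im ≠ 0) (x : H₁) :
      adjoint (Γ₁ w) x = star (g w) (adjoint (Γ₂ w) (U x)) := by
    refine ext_inner_left ℂ fun a => ?_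
    rw [ContinuousLinearMap.star_eq_adjoint, ContinuousLinearMap.adjoint_inner_right,
      ContinuousLinearMap.adjoint_inner_right, ContinuousLinearMap.adjoint_inner_right, ← hU w hw,
      U.inner_map_map]
  have hinj {w : ℂ} (hw : w.im ≠ 0) : Function.Injective (star (g w) : K →L[ℂ] K) := by
    obtain ⟨u, hu⟩ := (hg w hw).star
    rw [← hu]
    refine Function.LeftInverse.injective (g := (↑u⁻¹ : K →L[ℂ] K)) fun a => ?_
    rw [← mul_apply_eq_comp, Units.inv_mul, one_apply_eq_self]
  have key (x y : H₁) : (∃ g : T₁.domain, (g : H₁) = x ∧ T₁ g = y) ↔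
      ∃ g : T₂.domain, (g : H₂) = U x ∧ T₂ g = U y := by
    rw [← hΓ₁.adjoint_eq_smul_iff hT₁, ← hΓ₂.adjoint_eq_smul_iff hT₂]
    refine forall₂_congr fun w hw => ?_
    rw [hadj hw, hadj hw, ← map_smul, (hinj hw).eq_iff]
  refine ⟨U, fun x => ⟨fun hx => ?_, fun hx => ?_⟩, fun x y hxy => ?_⟩
  · obtain ⟨y, hy, -⟩ := (key x _).1 ⟨⟨x, hx⟩, rfl, rfl⟩
    exact hy ▸ y.2
  · obtain ⟨y, hy, -⟩ := (key x (U.symm (T₂ ⟨_, hx⟩))).2 ⟨⟨U x, hx⟩, rfl, by simp⟩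
    exact hy ▸ y.2
  · obtain ⟨y', hy, hy'⟩ := (key x _).1 ⟨x, rfl, rfl⟩
    rw [← hy', Subtype.ext (hy.trans hxy)]

theorem unitarilyEquivalent_of_charFun_eq (hT₁ : IsInClass n T₁) (hT₂ : IsInClass n T₂)
    (hΓ₁ : IsModel T₁ Γ₁) (hΓ₂ : IsModel T₂ Γ₂) (R Q : unitary (K →L[ℂ] K))
    (h : ∀ z : ℂ, 0 < z.im →
      charFun Γ₁ z = (R : K →L[ℂ] K) * charFun Γ₂ z * (Q : K →L[ℂ] K)) :
    UnitarilyEquivalent T₁ T₂ := by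
  set g : ℂ → K →L[ℂ] K := fun w => star (transition Γ₁ Γ₂ (R : K →L[ℂ] K) Q w) with hg
  have hu (w : ℂ) (hw : w.im ≠ 0) : IsUnit (g w) := (isUnit_transition hΓ₁ hΓ₂ R Q hw).star
  -- Composing with the invertible `g(w)` leaves the ranges unchanged and makes the two kernels
  -- equal.
  have hd : (⨆ (w : ℂ) (_ : w.im ≠ 0),
      LinearMap.range (Γ₂ w ∘L g w).toLinearMap).topologicalClosure = ⊤ := by
    rw [← hΓ₂.span_dense]
    congr 1
    refine iSup_congr fun w => iSup_congr fun hw => ?_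
    obtain ⟨u, hu⟩ := hu w hw
    have hsurj : LinearMap.range (g w).toLinearMap = ⊤ := by
      refine LinearMap.range_eq_top.2 fun a => ⟨(↑u⁻¹ : K →L[ℂ] K) a, ?_⟩
      change g w _ = a
      rw [← hu, ← mul_apply_eq_comp, Units.mul_inv, one_apply_eq_self]
    exact LinearMap.range_comp_of_range_eq_top (Γ₂ w).toLinearMap hsurj
  obtain ⟨U, hU⟩ := exists_isometry (Γ₂ := fun w => Γ₂ w ∘L g w) hΓ₁.span_dense hd
    fun w z hw hz => by
      rw [kernel_eq_transition_mul hT₁ hT₂ hΓ₁ hΓ₂ R Q h hw hz, kernel, kernel,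
        ContinuousLinearMap.adjoint_comp, ← ContinuousLinearMap.star_eq_adjoint (g z), hg,
        star_star]
      rfl
  exact unitarilyEquivalent_of_comp_eq hT₁ hT₂ hΓ₁ hΓ₂ U hu hU

end SymmetricOperator

end

theorem mainTheorem1 {H₁ H₂ K : Type*}
    [NormedAddCommGroup H₁] [InnerProductSpace ℂ H₁] [CompleteSpace H₁]
    [TopologicalSpace.SeparableSpace H₁]
    [NormedAddCommGroup H₂] [InnerProductSpace ℂ H₂] [CompleteSpace H₂]
    [TopologicalSpace.SeparableSpace H₂]
    [NormedAddCommGroup K] [InnerProductSpace ℂ K] [CompleteSpace K]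
    [TopologicalSpace.SeparableSpace K]
    (n : ℕ∞) (hK : SymmetricOperator.hilbertDim K = n)
    (T₁ : H₁ →ₗ.[ℂ] H₁) (hT₁ : SymmetricOperator.IsInClass n T₁)
    (T₂ : H₂ →ₗ.[ℂ] H₂) (hT₂ : SymmetricOperator.IsInClass n T₂)
    (Γ₁ : ℂ → K →L[ℂ] H₁) (hΓ₁ : SymmetricOperator.IsModel T₁ Γ₁)
    (Γ₂ : ℂ → K →L[ℂ] H₂) (hΓ₂ : SymmetricOperator.IsModel T₂ Γ₂) :
    SymmetricOperator.UnitarilyEquivalent T₁ T₂ ↔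
      ∃ R Q : unitary (K →L[ℂ] K), ∀ z : ℂ, 0 < z.im →
        SymmetricOperator.charFun Γ₁ z =
          (R : K →L[ℂ] K) * SymmetricOperator.charFun Γ₂ z * (Q : K →L[ℂ] K) :=
  ⟨fun h => SymmetricOperator.exists_charFun_eq h hΓ₁ hΓ₂, fun ⟨R, Q, h⟩ =>
    SymmetricOperator.unitarilyEquivalent_of_charFun_eq hT₁ hT₂ hΓ₁ hΓ₂ R Q h⟩
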